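/- Let $\phi_{i,j}\in C^\infty(\mathbb R)$ ($1\le i\le 3$, $1\le j\le 2$) satisfy $\phi_{i,1}'\phi_{i,2}'=1$ for $i=1,2,3$. On $\mathbb R^{14}$, with coordinates $x_i,x_i^*,y_{i,1},y_{i,2}$ ($1\le i\le3$) and $y_{4,1},y_{4,2}$, let $g_\Phi$ be the symmetric bilinear form whose non-zero components are, up to symmetry, $$g_\Phi(\partial_{x_i},\partial_{x_i^*})=g_\Phi(\partial_{y_{i,1}},\partial_{y_{i,2}})=1\quad(1\le i\le 3),$$ $$g_\Phi(\partial_{y_{4,1}},\partial_{y_{4,1}})=g_\Phi(\partial_{y_{4,2}},\partial_{y_{4,2}})=-\tfrac12,\qquad g_\Phi(\partial_{y_{4,1}},\partial_{y_{4,2}})=\tfrac14,$$ $$g_\Phi(\partial_{x_1},\partial_{x_1})=-2\phi_{2,1}(x_2)y_{2,1}-2\phi_{3,1}(x_3)y_{3,1},\qquad g_\Phi(\partial_{x_2},\partial_{x_3})=x_1y_{4,1},$$ $$g_\Phi(\partial_{x_2},\partial_{x_2})=-2\phi_{3,2}(x_3)y_{3,2}-2\phi_{1,2}(x_1)y_{1,2},\qquad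 g_\Phi(\partial_{x_1},\partial_{x_3})=x_2y_{4,2},$$ $$g_\Phi(\partial_{x_3},\partial_{x_3})=-2\phi_{1,1}(x_1)y_{1,1}-2\phi_{2,2}(x_2)y_{2,2}.$$ Let $\nabla$ be the Levi-Civita connection of $g_\Phi$, let $\mathcal R(X,Y)=\nabla_X\nabla_Y-\nabla_Y\nabla_X-\nabla_{[X,Y]}$, $R(x,y,z,w)=g_\Phi(\mathcal R(x,y)z,w)$, and let $\mathcal J(x)y=\mathcal R(y,x)x$ be the Jacobi operator. A $0$-model is a triple $(V,\langle\cdot,\cdot\rangle,A)$ of a finite-dimensional real vector space, a non-degenerate symmetric bilinear form, and an algebraic curvature tensor, i.e. a tensor $A\in\otimes^4V^*$ with $A(v_1,v_2,v_3,v_4)=-A(v_2,v_1,v_3,v_4)=A(v_3,v_4,v_1,v_2)$ and $A(v_1,v_2,v_3,v_4)+A(v_2,v_3,v_1,v_4)+A(v_3,v_1,v_2,v_4)=0$. Let $\mathfrak M_{14}$ be the $0$-model on $\mathbb R^{14}$ with basis $\alpha_i,\alpha_i^*,\beta_{i,1},\beta_{i,2}$ ($1\le i\le3$), $\beta_{4,1},\beta_{4,2}$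 whose non-zero components are, up to the symmetries above, $$\langle\alpha_i,\alpha_i^*\rangle=\langle\beta_{i,1},\beta_{i,2}\rangle=1\ (1\le i\le3),\quad \langle\beta_{4,1},\beta_{4,1}\rangle=\langle\beta_{4,2},\beta_{4,2}\rangle=-\tfrac12,\quad \langle\beta_{4,1},\beta_{4,2}\rangle=\tfrac14,$$ $$A(\alpha_2,\alpha_1,\alpha_1,\beta_{2,1})=A(\alpha_3,\alpha_1,\alpha_1,\beta_{3,1})=A(\alpha_3,\alpha_2,\alpha_2,\beta_{3,2})=1,$$ $$A(\alpha_1,\alpha_2,\alpha_2,\beta_{1,2})=A(\alpha_1,\alpha_3,\alpha_3,\beta_{1,1})=A(\alpha_2,\alpha_3,\alpha_3,\beta_{2,2})=1,$$ $$A(\alpha_1,\alpha_2,\alpha_3,\beta_{4,1})=A(\alpha_1,\alpha_3,\alpha_2,\beta_{4,1})=A(\alpha_2,\alpha_3,\alpha_1,\beta_{4,2})=A(\alpha_2,\alpha_1,\alpha_3,\beta_{4,2})=-\tfrac12.$$ Then $\mathfrak M_{14}$ is indeed a $0$-model, $g_\Phi$ is a smooth pseudo-Riemannian metric on $\mathbb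 R^{14}$, and $\mathcal M_\Phi=(\mathbb R^{14},g_\Phi)$ has the following properties. 1. $\mathcal M_\Phi$ is geodesically complete: every geodesic defined on an open interval extends to a geodesic defined on $\mathbb R$. 2. For every $P\in\mathbb R^{14}$, $\exp_P$ is a diffeomorphism from $T_P\mathbb R^{14}$ onto $\mathbb R^{14}$. 3. $\mathcal M_\Phi$ is $0$-curvature homogeneous with model $\mathfrak M_{14}$: for every $P\in\mathbb R^{14}$, $(T_P\mathbb R^{14},(g_\Phi)_P,R_P)$ is a $0$-model, and there is a linear isomorphism $\Theta_P:T_P\mathbb R^{14}\to\mathbb R^{14}$ with $\Theta_P^*\langle\cdot,\cdot\rangle=(g_\Phi)_P$ and $\Theta_P^*A=R_P$. 4. $\mathcal M_\Phi$ is Jacobi–Tsankov, i.e. $\mathcal J(x)\mathcal J(y)=\mathcal J(y)\mathcal J(x)$ for all $P$ and all $x,y\in T_P\mathbb R^{14}$, but it is not $2$-step Jacobi nilpotent, i.e. it is not the case that $\mathcal J(x)\mathcal J(y)=0$ for all $P$ and all $x,y\in T_P\mathbb R^{14}$. -/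

import Mathlib

open scoped ContDiff

namespace JTsankov

/-! ### Pseudo-Riemannian geometry of a metric on a coordinate space `ι → ℝ`

A metric is given by its matrix of components `g P a b = g_P(∂_a, ∂_b)`; the tangent space at each
point is identified with `ι → ℝ` through the coordinate frame. -/

section Geometry

variable {ι : Type} [Fintype ι] [DecidableEq ι]

/-- `g` is a smooth field of symmetric non-degenerate bilinear forms. -/
def IsPseudoRiemannian (g : (ι → ℝ) → Matrix ι ι ℝ) : Prop :=
  (∀ a b, ContDiff ℝ ∞ fun P => g P a b) ∧ ∀ P, (g P).IsSymm ∧ (g P).det ≠ 0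

/-- The partial derivative `∂_a f` at `P`. -/
noncomputable def partialDeriv (a : ι) (f : (ι → ℝ) → ℝ) (P : ι → ℝ) : ℝ :=
  fderiv ℝ f P (Pi.single a 1)

/-- The Christoffel symbol `Γ_{ab}^c` of the Levi-Civita connection of `g`. -/
noncomputable def christoffel (g : (ι → ℝ) → Matrix ι ι ℝ) (P : ι → ℝ) (a b c : ι) : ℝ :=
  (1 / 2) * ∑ d, (g P)⁻¹ c d *
    (partialDeriv a (fun Q => g Q b d) P + partialDeriv b (fun Q => g Q a d) P
      - partialDeriv d (fun Q => g Q a b) P)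

/-- The bilinear expression `Γ(v, w)`, with components `∑ Γ_{ab}^c v^a w^b`. -/
noncomputable def christoffelAt (g : (ι → ℝ) → Matrix ι ι ℝ) (P v w : ι → ℝ) : ι → ℝ :=
  fun c => ∑ a, ∑ b, christoffel g P a b c * v a * w b

/-- The Levi-Civita covariant derivative `∇_X Y` of vector fields. -/
noncomputable def nabla (g : (ι → ℝ) → Matrix ι ι ℝ) (X Y : (ι → ℝ) → (ι → ℝ)) :
    (ι → ℝ) → (ι → ℝ) :=
  fun P => fderiv ℝ Y P (X P) + christoffelAt g P (X P) (Y P)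

/-- The curvature operator on vector fields:
`R(X,Y)Z = ∇_X ∇_Y Z - ∇_Y ∇_X Z - ∇_{[X,Y]} Z`. -/
noncomputable def curvature (g : (ι → ℝ) → Matrix ι ι ℝ) (X Y Z : (ι → ℝ) → (ι → ℝ)) :
    (ι → ℝ) → (ι → ℝ) :=
  nabla g X (nabla g Y Z) - nabla g Y (nabla g X Z)
    - nabla g (VectorField.lieBracket ℝ X Y) Z

/-- The curvature operator `R_P(x,y)z` on tangent vectors at `P`. The curvature being tensorial,
the value does not depend on the vector fields that extend `x`, `y`, `z`; the fields with constant
coefficients are used. -/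
noncomputable def curvatureAt (g : (ι → ℝ) → Matrix ι ι ℝ) (P x y z : ι → ℝ) : ι → ℝ :=
  curvature g (fun _ => x) (fun _ => y) (fun _ => z) P

/-- The Jacobi operator `J_P(x)y = R_P(y,x)x`. -/
noncomputable def jacobi (g : (ι → ℝ) → Matrix ι ι ℝ) (P x y : ι → ℝ) : ι → ℝ :=
  curvatureAt g P y x x

/-- `J(x)J(y) = J(y)J(x)` for all vectors `x`, `y` tangent at the same point. -/
def IsJacobiTsankov (g : (ι → ℝ) → Matrix ι ι ℝ) : Prop :=
  ∀ P x y z, jacobi g P x (jacobi g P y z) = jacobi g P y (jacobi g P x z)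

/-- `J(x)J(y) = 0` for all vectors `x`, `y` tangent at the same point. -/
def IsTwoStepJacobiNilpotent (g : (ι → ℝ) → Matrix ι ι ℝ) : Prop :=
  ∀ P x y z, jacobi g P x (jacobi g P y z) = 0

/-- `γ` solves the geodesic equation `γ'' + Γ(γ', γ') = 0` on `s` (used for open `s`). -/
def IsGeodesicOn (g : (ι → ℝ) → Matrix ι ι ℝ) (γ : ℝ → (ι → ℝ)) (s : Set ℝ) : Prop :=
  ∀ t ∈ s, DifferentiableAt ℝ γ t ∧
    HasDerivAt (deriv γ) (-christoffelAt g (γ t) (deriv γ t) (deriv γ t)) t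

/-- Every geodesic defined on an open interval is the restriction of a geodesic defined on `ℝ`. -/
def IsGeodesicallyComplete (g : (ι → ℝ) → Matrix ι ι ℝ) : Prop :=
  ∀ (s : Set ℝ) (γ : ℝ → (ι → ℝ)), IsOpen s → s.OrdConnected → IsGeodesicOn g γ s →
    ∃ σ : ℝ → (ι → ℝ), IsGeodesicOn g σ Set.univ ∧ Set.EqOn σ γ s

/-- `f` is the exponential map `exp_P`, defined on the whole tangent space at `P`: the value `f v`
is the one and only point of the form `γ 1` with `γ` a geodesic such that `γ 0 = P` and
`γ' 0 = v`. -/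
def IsExpMap (g : (ι → ℝ) → Matrix ι ι ℝ) (P : ι → ℝ) (f : (ι → ℝ) → (ι → ℝ)) : Prop :=
  ∀ v q, f v = q ↔
    ∃ γ : ℝ → (ι → ℝ), IsGeodesicOn g γ Set.univ ∧ γ 0 = P ∧ deriv γ 0 = v ∧ γ 1 = q

end Geometry

/-! ### 0-models -/

/-- The data `(⟨·,·⟩, A)` of a 0-model on `V`. -/
structure ModelData (V : Type) [AddCommGroup V] [Module ℝ V] where
  form : LinearMap.BilinForm ℝ V
  curv : V → V → V → V → ℝ

/-- The data form a 0-model: `⟨·,·⟩` is a non-degenerate symmetric form and `A` is an algebraic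
curvature tensor. -/
structure ModelData.IsZeroModel {V : Type} [AddCommGroup V] [Module ℝ V] (M : ModelData V) :
    Prop where
  form_symm : ∀ v w, M.form v w = M.form w v
  form_nondegenerate : ∀ v, (∀ w, M.form v w = 0) → v = 0
  curv_multilinear : ∃ T : MultilinearMap ℝ (fun _ : Fin 4 => V) ℝ,
    ∀ v₁ v₂ v₃ v₄, M.curv v₁ v₂ v₃ v₄ = T ![v₁, v₂, v₃, v₄]
  curv_skew : ∀ v₁ v₂ v₃ v₄, M.curv v₁ v₂ v₃ v₄ = -M.curv v₂ v₁ v₃ v₄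
  curv_pair : ∀ v₁ v₂ v₃ v₄, M.curv v₁ v₂ v₃ v₄ = M.curv v₃ v₄ v₁ v₂
  curv_bianchi : ∀ v₁ v₂ v₃ v₄,
    M.curv v₁ v₂ v₃ v₄ + M.curv v₂ v₃ v₁ v₄ + M.curv v₃ v₁ v₂ v₄ = 0

/-- There is a linear isomorphism that pulls back the form and the tensor of `N` to those
of `M`. -/
def ModelData.IsIsomorphic {V W : Type} [AddCommGroup V] [Module ℝ V] [AddCommGroup W]
    [Module ℝ W] (M : ModelData V) (N : ModelData W) : Prop :=
  ∃ Θ : V ≃ₗ[ℝ] W,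
    (∀ v w, N.form (Θ v) (Θ w) = M.form v w) ∧
    ∀ v₁ v₂ v₃ v₄, N.curv (Θ v₁) (Θ v₂) (Θ v₃) (Θ v₄) = M.curv v₁ v₂ v₃ v₄

/-- The 0-model `(T_P M, g_P, R_P)`, where `R_P(x,y,z,w) = g_P(R_P(x,y)z, w)`. -/
noncomputable def modelAt {ι : Type} [Fintype ι] [DecidableEq ι]
    (g : (ι → ℝ) → Matrix ι ι ℝ) (P : ι → ℝ) : ModelData (ι → ℝ) where
  form := Matrix.toBilin' (g P)
  curv x y z w := Matrix.toBilin' (g P) (curvatureAt g P x y z) w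

/-- The metric is 0-curvature homogeneous with model `M`. -/
def HasZeroModel {ι : Type} [Fintype ι] [DecidableEq ι] (g : (ι → ℝ) → Matrix ι ι ℝ)
    {V : Type} [AddCommGroup V] [Module ℝ V] (M : ModelData V) : Prop :=
  ∀ P, (modelAt g P).IsZeroModel ∧ (modelAt g P).IsIsomorphic M

/-! ### The 14-dimensional model and the metrics -/

/-- Labels for the 14 coordinates `x_i`, `x_i^*` (`i = 1, 2, 3`) and `y_{i,j}`
(`i = 1, 2, 3, 4`, `j = 1, 2`). The numbering in the code starts from `0`. -/
abbrev Coord : Type := Fin 3 ⊕ Fin 3 ⊕ (Fin 4 × Fin 2)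

/-- The label of `x_i`, and of the basis vector `α_i`. -/
abbrev X (i : Fin 3) : Coord := Sum.inl i

/-- The label of `x_i^*`, and of the basis vector `α_i^*`. -/
abbrev XS (i : Fin 3) : Coord := Sum.inr (Sum.inl i)

/-- The label of `y_{i,j}`, and of the basis vector `β_{i,j}`. -/
abbrev Y (i : Fin 4) (j : Fin 2) : Coord := Sum.inr (Sum.inr (i, j))

/-- The constant inner products of the `y`-directions: `⟨β_{i,1}, β_{i,2}⟩ = 1` for `i ≤ 3`,
`⟨β_{4,1}, β_{4,1}⟩ = ⟨β_{4,2}, β_{4,2}⟩ = -1/2`, `⟨β_{4,1}, β_{4,2}⟩ = 1/4`. -/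
noncomputable def yBlock (a b : Fin 4 × Fin 2) : ℝ :=
  if a.1 = b.1 then
    if a.1 = 3 then (if a.2 = b.2 then -(1 / 2) else 1 / 4)
    else (if a.2 = b.2 then 0 else 1)
  else 0

/-- The symmetric matrix with the block `B` in the `x`-directions, with
`⟨x_i, x_i^*⟩ = 1`, with the block `yBlock` in the `y`-directions, and zero otherwise. -/
noncomputable def blockForm (B : Matrix (Fin 3) (Fin 3) ℝ) : Matrix Coord Coord ℝ
  | Sum.inl i, Sum.inl j => B i j
  | Sum.inl i, Sum.inr (Sum.inl j) => if i = j then 1 else 0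
  | Sum.inr (Sum.inl i), Sum.inl j => if i = j then 1 else 0
  | Sum.inr (Sum.inr a), Sum.inr (Sum.inr b) => yBlock a b
  | _, _ => 0

/-- The listed components `A(α_i, α_j, α_k, β_{l,m})` of the model tensor. -/
noncomputable def listedComponent (i j k : Fin 3) (l : Fin 4) (m : Fin 2) : ℝ :=
  if (i, j, k, l, m) ∈ ({(1, 0, 0, 1, 0), (2, 0, 0, 2, 0), (2, 1, 1, 2, 1), (0, 1, 1, 0, 1),
      (0, 2, 2, 0, 0), (1, 2, 2, 1, 1)} : Finset (Fin 3 × Fin 3 × Fin 3 × Fin 4 × Fin 2)) then 1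
  else if (i, j, k, l, m) ∈ ({(0, 1, 2, 3, 0), (0, 2, 1, 3, 0), (1, 2, 0, 3, 1), (1, 0, 2, 3, 1)} :
      Finset (Fin 3 × Fin 3 × Fin 3 × Fin 4 × Fin 2)) then -(1 / 2)
  else 0

/-- All components `A(α_i, α_j, α_k, β_{l,m})`, skew-symmetric in `i`, `j`. -/
noncomputable def component (i j k : Fin 3) (l : Fin 4) (m : Fin 2) : ℝ :=
  listedComponent i j k l m - listedComponent j i k l m

/-- All components of the model tensor: those with exactly one entry `β_{l,m}` and three entries
among the `α_i` are obtained by the symmetries from `A(α_i, α_j, α_k, β_{l,m})`, and the other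
ones vanish. -/
noncomputable def modelCurv : Coord → Coord → Coord → Coord → ℝ
  | Sum.inl i, Sum.inl j, Sum.inl k, Sum.inr (Sum.inr (l, m)) => component i j k l m
  | Sum.inl i, Sum.inl j, Sum.inr (Sum.inr (l, m)), Sum.inl k => -component i j k l m
  | Sum.inl k, Sum.inr (Sum.inr (l, m)), Sum.inl i, Sum.inl j => component i j k l m
  | Sum.inr (Sum.inr (l, m)), Sum.inl k, Sum.inl i, Sum.inl j => -component i j k l m
  | _, _, _, _ => 0

/-- The model `𝔐₁₄`; `{α_i, α_i^*, β_{i,j}}` is the standard basis of `Coord → ℝ`. -/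
noncomputable def model14 : ModelData (Coord → ℝ) where
  form := Matrix.toBilin' (blockForm 0)
  curv v₁ v₂ v₃ v₄ := ∑ a, ∑ b, ∑ c, ∑ d, modelCurv a b c d * v₁ a * v₂ b * v₃ c * v₄ d

/-- The metric `g_Φ`; `φ i j` is the function `φ_{i+1,j+1}`. -/
noncomputable def gPhi (φ : Fin 3 → Fin 2 → ℝ → ℝ) (p : Coord → ℝ) : Matrix Coord Coord ℝ :=
  blockForm !![
    -2 * φ 1 0 (p (X 1)) * p (Y 1 0) - 2 * φ 2 0 (p (X 2)) * p (Y 2 0), 0, p (X 1) * p (Y 3 1);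
    0, -2 * φ 2 1 (p (X 2)) * p (Y 2 1) - 2 * φ 0 1 (p (X 0)) * p (Y 0 1), p (X 0) * p (Y 3 0);
    p (X 1) * p (Y 3 1), p (X 0) * p (Y 3 0),
      -2 * φ 0 0 (p (X 0)) * p (Y 0 0) - 2 * φ 1 1 (p (X 1)) * p (Y 1 1)]

end JTsankov

namespace JTsankov

/-! Give the `x`, `y`, `x*` coordinates levels 0, 1, 2. The metric is constant except for its
`x`-block, which depends only on `x` and `y`. Hence `Γ(v, v)` has no `x`-components, its
`y`-components involve only the `x`-parts of point and velocity, and its `x*`-components only the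
`x`- and `y`-parts (`gammaPhi`). The geodesic equation is thus triangular: it is solved on all of
`ℝ` by successive quadratures, uniquely and smoothly in the initial velocity. Moreover `exp_P` minus
the identity has components depending only on lower levels of the velocity, so `exp_P` inverts level
by level.

For the curvature, `modelAt_gPhi_curv` gives a part with one `y`-slot, which is the model tensor
rescaled by the `φ_{i,j}'`, plus a part on the `x`-directions alone. Since `φ_{i,1}'φ_{i,2}' = 1`,
rescaling the `y`-directions preserves the form. Shifting `∂_{x_i}` by multiples of the `β`'s
absorbs the second part, and a correction along the `α_i^*` restores the inner products
(`frameMap`).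

Jacobi operators take values with no `x`-component, and the `φ'` cancel in a composition. With
determinants taken on `x`-components, `⟨J(x)J(y)z, w⟩ = det(x,y,z) det(x,y,w)`. This is symmetric in
`x`, `y` and not identically zero. -/

/-! ### Smooth dependence of integrals on parameters -/

open MeasureTheory in
theorem hasFDerivAt_intervalIntegral_of_contDiff {E F : Type*} [NormedAddCommGroup E]
    [NormedSpace ℝ E] [ProperSpace E] [NormedAddCommGroup F] [NormedSpace ℝ F] [CompleteSpace F]
    {f : E → ℝ → F} (hf : ContDiff ℝ 1 (Function.uncurry f)) (a b : ℝ) (x₀ : E) :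
    HasFDerivAt (fun x => ∫ t in a..b, f x t) (∫ t in a..b, fderiv ℝ (fun x => f x t) x₀) x₀ := by
  have hd : Continuous (Function.uncurry fun (x : E) (t : ℝ) => fderiv ℝ (fun x => f x t) x) := by
    have : ContDiff ℝ 0 (fun p : E × ℝ => fderiv ℝ (fun x => f x p.2) p.1) :=
      ContDiff.fderiv (f := fun (p : E × ℝ) (x : E) => f x p.2) (n := 0) (m := 1)
        (hf.comp ((contDiff_snd).prodMk (contDiff_snd.comp contDiff_fst))) contDiff_fst (by norm_num)
    exact this.continuous
  obtain ⟨C, hC⟩ := ((isCompact_closedBall x₀ 1).prod (isCompact_uIcc (a := a) (b := b))).exists_bound_of_continuousOn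
    hd.continuousOn
  refine intervalIntegral.hasFDerivAt_integral_of_dominated_of_fderiv_le (F := f)
    (F' := fun x t => fderiv ℝ (fun x => f x t) x) (bound := fun _ => C)
    (Metric.ball_mem_nhds x₀ one_pos) ?_ ?_ ?_ ?_ ?_ ?_
  · exact Filter.Eventually.of_forall fun x =>
      (hf.continuous.comp (Continuous.prodMk_right x)).aestronglyMeasurable
  · exact (hf.continuous.comp (Continuous.prodMk_right x₀)).intervalIntegrable _ _
  · exact (hd.comp (Continuous.prodMk_right x₀)).aestronglyMeasurable
  · exact Filter.Eventually.of_forall fun t ht x hx =>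
      hC (x, t) ⟨Metric.ball_subset_closedBall hx, Set.uIoc_subset_uIcc ht⟩
  · exact intervalIntegrable_const
  · refine Filter.Eventually.of_forall fun t _ x _ => ?_
    have : Differentiable ℝ (fun x => f x t) :=
      (hf.comp (contDiff_id.prodMk contDiff_const)).differentiable one_ne_zero
    exact (this x).hasFDerivAt

/-- Induction on `n` for all targets at once: the derivative of the integral is the integral of a
family with values in `E →L[ℝ] F`. -/
theorem contDiff_intervalIntegral {E : Type} [NormedAddCommGroup E]
    [NormedSpace ℝ E] [ProperSpace E] (a b : ℝ) (n : ℕ) :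
    ∀ {F : Type} [NormedAddCommGroup F] [NormedSpace ℝ F] [CompleteSpace F]
    {f : E → ℝ → F} (_ : ContDiff ℝ n (Function.uncurry f)),
    ContDiff ℝ n (fun x => ∫ t in a..b, f x t) := by
  induction n with
  | zero =>
    intro F _ _ _ f hf
    exact contDiff_zero.2
      (intervalIntegral.continuous_parametric_intervalIntegral_of_continuous' hf.continuous a b)
  | succ n ih =>
    intro F _ _ _ f hf
    refine contDiff_succ_iff_hasFDerivAt.2 ⟨_, ih (f := fun x t => fderiv ℝ (fun x => f x t) x) ?_,
      fun x => hasFDerivAt_intervalIntegral_of_contDiff (hf.of_le (by simp)) a b x⟩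
    exact ContDiff.fderiv (f := fun (p : E × ℝ) (x : E) => f x p.2) (n := n) (m := (n + 1 : ℕ))
        (hf.comp ((contDiff_snd).prodMk (contDiff_snd.comp contDiff_fst))) contDiff_fst (by simp)

/-- A smooth family of functions of one variable has a smooth family of primitives. -/
theorem exists_contDiff_primitive {E F : Type} [NormedAddCommGroup E] [NormedSpace ℝ E]
    [ProperSpace E] [NormedAddCommGroup F] [NormedSpace ℝ F] [CompleteSpace F]
    {f : E × ℝ → F} (hf : ContDiff ℝ ∞ f) (t₀ : ℝ) {c : E → F} (hc : ContDiff ℝ ∞ c) :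
    ∃ u : E × ℝ → F, ContDiff ℝ ∞ u ∧ (∀ x, u (x, t₀) = c x) ∧
      ∀ x t, HasDerivAt (fun s => u (x, s)) (f (x, t)) t := by
  have hfc : ∀ x, Continuous fun s => f (x, s) := fun x =>
    hf.continuous.comp (Continuous.prodMk_right x)
  -- The integral over `[t₀, t]` is rescaled to `[0, 1]`, so that the endpoint becomes one more
  -- parameter of the integrand.
  refine ⟨fun p => c p.1 + (p.2 - t₀) • ∫ s in (0 : ℝ)..1, f (p.1, (p.2 - t₀) * s + t₀), ?_, ?_, ?_⟩
  · refine (hc.comp contDiff_fst).add ((contDiff_snd.sub contDiff_const).smul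
      (contDiff_infty.2 fun n => ?_))
    refine contDiff_intervalIntegral 0 1 n (f := fun (p : E × ℝ) s => f (p.1, (p.2 - t₀) * s + t₀)) ?_
    refine ContDiff.of_le (n := ∞) ?_ (by exact_mod_cast le_top)
    unfold Function.uncurry
    fun_prop
  · simp
  · intro x t
    have : (fun s : ℝ => c x + (s - t₀) • ∫ r in (0 : ℝ)..1, f (x, (s - t₀) * r + t₀))
        = fun s => c x + ∫ r in t₀..s, f (x, r) := by
      funext s
      rw [intervalIntegral.smul_integral_comp_mul_add (fun r => f (x, r))]
      simp
    simp only [this]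
    exact ((hfc x).integral_hasStrictDerivAt t₀ t).hasDerivAt.const_add _

/-- Two functions with equal second derivatives on an interval and equal initial data agree. -/
theorem eqOn_of_secondDeriv_eq {s : Set ℝ} (ho : IsOpen s) (hs : s.OrdConnected)
    {f g f' g' h : ℝ → ℝ}
    (hf : ∀ t ∈ s, HasDerivAt f (f' t) t) (hg : ∀ t ∈ s, HasDerivAt g (g' t) t)
    (hf' : ∀ t ∈ s, HasDerivAt f' (h t) t) (hg' : ∀ t ∈ s, HasDerivAt g' (h t) t)
    {t₀ : ℝ} (ht₀ : t₀ ∈ s) (h₀ : f t₀ = g t₀) (h₁ : f' t₀ = g' t₀) :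
    Set.EqOn f g s ∧ Set.EqOn f' g' s := by
  have key : ∀ {u v w : ℝ → ℝ}, (∀ t ∈ s, HasDerivAt u (w t) t) →
      (∀ t ∈ s, HasDerivAt v (w t) t) → u t₀ = v t₀ → Set.EqOn u v s := by
    intro u v w hu hv h
    refine ho.eqOn_of_deriv_eq hs.isPreconnected
      (fun t ht => (hu t ht).differentiableAt.differentiableWithinAt)
      (fun t ht => (hv t ht).differentiableAt.differentiableWithinAt)
      (fun t ht => ?_) ht₀ h
    rw [(hu t ht).deriv, (hv t ht).deriv]
  have h' := key hf' hg' h₁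
  exact ⟨key hf (fun t ht => by rw [h' ht]; exact hg t ht) h₀, h'⟩

/-! ### Triangular second-order systems and triangular maps -/

section Triangular

variable {ι : Type} (lev : ι → ℕ)

/-- The components of level less than `n` of `v` and `w` agree. -/
def AgreeBelow (n : ℕ) (v w : ι → ℝ) : Prop := ∀ c, lev c < n → v c = w c

/-- The components of `F (p, v)` of level `n` depend only on those of `p` and `v` of level less
than `n`. -/
def IsTriangular (F : (ι → ℝ) × (ι → ℝ) → ι → ℝ) : Prop :=
  ∀ p q c, AgreeBelow lev (lev c) p.1 q.1 → AgreeBelow lev (lev c) p.2 q.2 → F p c = F q c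

/-- `u` solves `u'' = F (u, u')` on `s`, and `u'` is its velocity. -/
def IsSolutionOn (F : (ι → ℝ) × (ι → ℝ) → ι → ℝ) (u u' : ℝ → ι → ℝ) (s : Set ℝ) : Prop :=
  ∀ t ∈ s, HasDerivAt u (u' t) t ∧ HasDerivAt u' (F (u t, u' t)) t

variable {lev} {F : (ι → ℝ) × (ι → ℝ) → ι → ℝ}

/-- Solutions whose initial data agree below level `n` agree below level `n`. -/
theorem IsTriangular.agreeBelow_of_isSolutionOn (hF : IsTriangular lev F) {s : Set ℝ}
    (ho : IsOpen s) (hs : s.OrdConnected) {u u' w w' : ℝ → ι → ℝ} (hu : IsSolutionOn F u u' s)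
    (hw : IsSolutionOn F w w' s) {t₀ : ℝ} (ht₀ : t₀ ∈ s) (n : ℕ)
    (h₀ : AgreeBelow lev n (u t₀) (w t₀)) (h₁ : AgreeBelow lev n (u' t₀) (w' t₀)) :
    ∀ t ∈ s, AgreeBelow lev n (u t) (w t) ∧ AgreeBelow lev n (u' t) (w' t) := by
  induction n with
  | zero => exact fun t _ => ⟨fun c hc => absurd hc (by simp), fun c hc => absurd hc (by simp)⟩
  | succ n ih =>
    have ih := ih (fun c hc => h₀ c (by omega)) (fun c hc => h₁ c (by omega))
    have key : ∀ c, lev c < n + 1 → Set.EqOn (fun t => u t c) (fun t => w t c) s ∧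
        Set.EqOn (fun t => u' t c) (fun t => w' t c) s := by
      intro c hc
      refine eqOn_of_secondDeriv_eq ho hs (h := fun t => F (u t, u' t) c)
        (fun t ht => hasDerivAt_pi.1 (hu t ht).1 c) (fun t ht => hasDerivAt_pi.1 (hw t ht).1 c)
        (fun t ht => hasDerivAt_pi.1 (hu t ht).2 c) (fun t ht => ?_) ht₀ (h₀ c hc) (h₁ c hc)
      have := hF (u t, u' t) (w t, w' t) c (fun d hd => (ih t ht).1 d (by omega))
        (fun d hd => (ih t ht).2 d (by omega))
      rw [this]
      exact hasDerivAt_pi.1 (hw t ht).2 c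
    exact fun t ht => ⟨fun c hc => (key c hc).1 ht, fun c hc => (key c hc).2 ht⟩

theorem IsTriangular.eqOn_of_isSolutionOn (hF : IsTriangular lev F) {s : Set ℝ}
    (ho : IsOpen s) (hs : s.OrdConnected) {u u' w w' : ℝ → ι → ℝ} (hu : IsSolutionOn F u u' s)
    (hw : IsSolutionOn F w w' s) {t₀ : ℝ} (ht₀ : t₀ ∈ s) (h₀ : u t₀ = w t₀)
    (h₁ : u' t₀ = w' t₀) : Set.EqOn u w s := fun t ht => funext fun c =>
  (hF.agreeBelow_of_isSolutionOn ho hs hu hw ht₀ (lev c + 1) (fun _ _ => by rw [h₀])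
    (fun _ _ => by rw [h₁]) t ht).1 c (Nat.lt_succ_self _)

variable [Fintype ι]

/-- A smooth triangular system has global solutions, which depend smoothly on the initial
velocity. -/
theorem IsTriangular.exists_flow (hF : IsTriangular lev F) (hsm : ContDiff ℝ ∞ F) (P : ι → ℝ)
    (t₀ : ℝ) :
    ∃ u u' : (ι → ℝ) × ℝ → ι → ℝ, ContDiff ℝ ∞ u ∧ ContDiff ℝ ∞ u' ∧
      (∀ v, u (v, t₀) = P) ∧ (∀ v, u' (v, t₀) = v) ∧
      ∀ v, IsSolutionOn F (fun t => u (v, t)) (fun t => u' (v, t)) Set.univ := by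
  have step : ∀ f : (ι → ℝ) × ℝ → ι → ℝ, ContDiff ℝ ∞ f →
      ∃ u u' : (ι → ℝ) × ℝ → ι → ℝ, ContDiff ℝ ∞ u ∧ ContDiff ℝ ∞ u' ∧
      (∀ v, u (v, t₀) = P) ∧ (∀ v, u' (v, t₀) = v) ∧
      (∀ v t, HasDerivAt (fun s => u (v, s)) (u' (v, t)) t) ∧
      ∀ v t, HasDerivAt (fun s => u' (v, s)) (f (v, t)) t := by
    intro f hf
    obtain ⟨u', h1, h2, h3⟩ := exists_contDiff_primitive hf t₀ (c := id) contDiff_id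
    obtain ⟨u, h4, h5, h6⟩ := exists_contDiff_primitive h1 t₀ (c := fun _ => P) contDiff_const
    exact ⟨u, u', h4, h1, h5, h2, h6, h3⟩
  -- Picard iteration gains one level at each step, so it reaches an exact solution after finitely
  -- many steps and no convergence is needed.
  have picard : ∀ n : ℕ, ∃ u u' : (ι → ℝ) × ℝ → ι → ℝ, ContDiff ℝ ∞ u ∧ ContDiff ℝ ∞ u' ∧
      (∀ v, u (v, t₀) = P) ∧ (∀ v, u' (v, t₀) = v) ∧
      (∀ v t, HasDerivAt (fun s => u (v, s)) (u' (v, t)) t) ∧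
      ∀ v t c, lev c < n →
        HasDerivAt (fun s => u' (v, s) c) (F (u (v, t), u' (v, t)) c) t := by
    intro n
    induction n with
    | zero =>
      obtain ⟨u, u', h1, h2, h3, h4, h5, -⟩ := step 0 contDiff_const
      exact ⟨u, u', h1, h2, h3, h4, h5, fun v t c hc => absurd hc (by simp)⟩
    | succ n ih =>
      obtain ⟨w, w', g1, g2, g3, g4, g5, g6⟩ := ih
      obtain ⟨u, u', h1, h2, h3, h4, h5, h6⟩ :=
        step (fun p => F (w p, w' p)) (hsm.comp (g1.prodMk g2))
      refine ⟨u, u', h1, h2, h3, h4, h5, fun v t c hc => ?_⟩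
      -- Below level `n` the old iterate already solves its equations, so both iterates have the
      -- same second derivative and the same initial data.
      have agree : ∀ d, lev d < n → u (v, t) d = w (v, t) d ∧ u' (v, t) d = w' (v, t) d := by
        intro d hd
        have := eqOn_of_secondDeriv_eq isOpen_univ Set.ordConnected_univ
          (fun t _ => hasDerivAt_pi.1 (h5 v t) d) (fun t _ => hasDerivAt_pi.1 (g5 v t) d)
          (fun t _ => hasDerivAt_pi.1 (h6 v t) d) (fun t _ => g6 v t d hd) (Set.mem_univ t₀)
          (by rw [h3, g3]) (by rw [h4, g4])
        exact ⟨this.1 (Set.mem_univ t), this.2 (Set.mem_univ t)⟩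
      rw [hF (u (v, t), u' (v, t)) (w (v, t), w' (v, t)) c
        (fun d hd => (agree d (by omega)).1) (fun d hd => (agree d (by omega)).2)]
      exact hasDerivAt_pi.1 (h6 v t) c
  obtain ⟨u, u', h1, h2, h3, h4, h5, h6⟩ := picard (Finset.univ.sup lev + 1)
  exact ⟨u, u', h1, h2, h3, h4, fun v t _ => ⟨h5 v t, hasDerivAt_pi.2 fun c =>
    h6 v t c (Nat.lt_succ_of_le (Finset.le_sup (Finset.mem_univ c)))⟩⟩

/-- A smooth map which differs from the identity by a map that strictly raises the level is a
diffeomorphism. -/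
theorem exists_diffeomorph_of_triangular {f : (ι → ℝ) → ι → ℝ} (hf : ContDiff ℝ ∞ f)
    (ht : ∀ v w c, AgreeBelow lev (lev c) v w → f v c - v c = f w c - w c) :
    ∃ e : Diffeomorph (modelWithCornersSelf ℝ (ι → ℝ)) (modelWithCornersSelf ℝ (ι → ℝ))
      (ι → ℝ) (ι → ℝ) ∞, ∀ v, e v = f v := by
  have inj : ∀ n v w, AgreeBelow lev n (f v) (f w) → AgreeBelow lev n v w := by
    intro n v w
    induction n with
    | zero => exact fun _ c hc => absurd hc (by simp)
    | succ n ih =>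
      intro h c hc
      have ih := ih fun d hd => h d (by omega)
      have h1 := ht v w c fun d hd => ih d (by omega)
      have h2 := h c hc
      linarith
  have inv : ∀ n : ℕ, ∃ G : (ι → ℝ) → ι → ℝ, ContDiff ℝ ∞ G ∧
      ∀ q, AgreeBelow lev n (f (G q)) q := by
    intro n
    induction n with
    | zero => exact ⟨id, contDiff_id, fun q c hc => absurd hc (by simp)⟩
    | succ n ih =>
      obtain ⟨G, hG, h⟩ := ih
      -- Fixed-point step for `v = q - (f v - v)`: the bracket sees only lower levels, where `G` is
      -- already a right inverse.
      refine ⟨fun q => q - (f (G q) - G q), contDiff_id.sub ((hf.comp hG).sub hG), ?_⟩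
      intro q c hc
      have := ht (q - (f (G q) - G q)) (G q) c fun d hd => by
        have := h q d (by omega)
        simp only [Pi.sub_apply]
        linarith
      simp only [Pi.sub_apply] at this ⊢
      linarith
  obtain ⟨G, hG, h⟩ := inv (Finset.univ.sup lev + 1)
  have lt : ∀ c, lev c < Finset.univ.sup lev + 1 := fun c =>
    Nat.lt_succ_of_le (Finset.le_sup (Finset.mem_univ c))
  have right : ∀ q, f (G q) = q := fun q => funext fun c => h q c (lt c)
  refine ⟨⟨⟨f, G, fun v => funext fun c => ?_, right⟩, hf.contMDiff, hG.contMDiff⟩, fun _ => rfl⟩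
  exact inj _ _ _ (fun d _ => by rw [right]) c (lt c)

end Triangular

/-! ### Geodesic completeness and the exponential map -/

section Geodesics

variable {ι : Type} [Fintype ι] [DecidableEq ι] {g : (ι → ℝ) → Matrix ι ι ℝ}

theorem IsGeodesicOn.isSolutionOn {γ : ℝ → ι → ℝ} {s : Set ℝ} (h : IsGeodesicOn g γ s) :
    IsSolutionOn (fun p => -christoffelAt g p.1 p.2 p.2) γ (deriv γ) s :=
  fun t ht => ⟨(h t ht).1.hasDerivAt, (h t ht).2⟩

theorem IsSolutionOn.isGeodesicOn {γ γ' : ℝ → ι → ℝ}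
    (h : IsSolutionOn (fun p => -christoffelAt g p.1 p.2 p.2) γ γ' Set.univ) :
    IsGeodesicOn g γ Set.univ ∧ deriv γ = γ' := by
  have hd : deriv γ = γ' := funext fun t => (h t (Set.mem_univ t)).1.deriv
  refine ⟨fun t ht => ⟨(h t ht).1.differentiableAt, ?_⟩, hd⟩
  rw [hd]
  exact (h t ht).2

variable {lev : ι → ℕ}

theorem isGeodesicallyComplete_of_isTriangular
    (hsm : ContDiff ℝ ∞ fun p : (ι → ℝ) × (ι → ℝ) => -christoffelAt g p.1 p.2 p.2)
    (hF : IsTriangular lev fun p => -christoffelAt g p.1 p.2 p.2) :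
    IsGeodesicallyComplete g := by
  intro s γ ho hs hγ
  rcases s.eq_empty_or_nonempty with rfl | ⟨t₀, ht₀⟩
  · obtain ⟨u, u', -, -, -, -, h⟩ := hF.exists_flow hsm 0 0
    exact ⟨_, (h 0).isGeodesicOn.1, Set.eqOn_empty _ _⟩
  · obtain ⟨u, u', -, -, h0, h1, h⟩ := hF.exists_flow hsm (γ t₀) t₀
    refine ⟨_, (h (deriv γ t₀)).isGeodesicOn.1, ?_⟩
    exact hF.eqOn_of_isSolutionOn ho hs (fun t _ => h (deriv γ t₀) t (Set.mem_univ t))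
      hγ.isSolutionOn ht₀ (h0 _) (h1 _)

theorem exists_diffeomorph_isExpMap_of_isTriangular
    (hsm : ContDiff ℝ ∞ fun p : (ι → ℝ) × (ι → ℝ) => -christoffelAt g p.1 p.2 p.2)
    (hF : IsTriangular lev fun p => -christoffelAt g p.1 p.2 p.2) (P : ι → ℝ) :
    ∃ e : Diffeomorph (modelWithCornersSelf ℝ (ι → ℝ)) (modelWithCornersSelf ℝ (ι → ℝ))
      (ι → ℝ) (ι → ℝ) ∞, IsExpMap g P e := by
  obtain ⟨u, u', hu, -, h0, h1, h⟩ := hF.exists_flow hsm P 0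
  obtain ⟨e, he⟩ := exists_diffeomorph_of_triangular (lev := lev) (f := fun v => u (v, 1))
    (hu.comp (contDiff_id.prodMk contDiff_const)) (by
      intro v w c hvw
      have agree := hF.agreeBelow_of_isSolutionOn isOpen_univ Set.ordConnected_univ (h v) (h w)
        (Set.mem_univ 0) (lev c) (fun d _ => by simp only [h0]) (fun d hd => by
          simp only [h1]; exact hvw d hd)
      have lin : ∀ (a t : ℝ), HasDerivAt (fun t : ℝ => t * a) a t := fun a t => by
        simpa using (hasDerivAt_id t).mul_const a
      -- Subtracting `t * v c` makes the initial value `P c` and the initial slope 0 independent of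
      -- `v`. The second derivative depends only on lower levels, so at time 1 the difference `exp_P
      -- v - v` does too.
      have := eqOn_of_secondDeriv_eq isOpen_univ Set.ordConnected_univ
        (f := fun t => u (v, t) c - t * v c) (g := fun t => u (w, t) c - t * w c)
        (fun t ht => (hasDerivAt_pi.1 (h v t ht).1 c).sub (lin _ t))
        (fun t ht => (hasDerivAt_pi.1 (h w t ht).1 c).sub (lin _ t))
        (fun t ht => (hasDerivAt_pi.1 (h v t ht).2 c).sub_const _)
        (fun t ht => by
          have e := hF (u (v, t), u' (v, t)) (u (w, t), u' (w, t)) c (agree t ht).1 (agree t ht).2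
          simp only at e ⊢
          rw [e]
          exact (hasDerivAt_pi.1 (h w t ht).2 c).sub_const _)
        (Set.mem_univ 0) (by simp [h0]) (by simp [h1])
      simpa using this.1 (Set.mem_univ 1))
  refine ⟨e, fun v q => ?_⟩
  rw [he]
  constructor
  · rintro rfl
    obtain ⟨hg, hd⟩ := (h v).isGeodesicOn
    exact ⟨_, hg, h0 v, by rw [hd]; exact h1 v, rfl⟩
  · rintro ⟨γ, hγ, h2, h3, rfl⟩
    exact hF.eqOn_of_isSolutionOn isOpen_univ Set.ordConnected_univ (h v) hγ.isSolutionOn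
      (Set.mem_univ 0) ((h0 v).trans h2.symm) ((h1 v).trans h3.symm) (Set.mem_univ 1)

end Geodesics

/-! ### Christoffel symbols of the metric -/

section Christoffel

variable {ι : Type} [Fintype ι] [DecidableEq ι]

theorem fderiv_eq_sum_partialDeriv (f : (ι → ℝ) → ℝ) (P v : ι → ℝ) :
    fderiv ℝ f P v = ∑ a, partialDeriv a f P * v a := by
  conv_lhs => rw [pi_eq_sum_univ' v]
  rw [map_sum]
  refine Finset.sum_congr rfl fun a _ => ?_
  rw [map_smul, smul_eq_mul, mul_comm, partialDeriv]

/-- Contracting first leaves directional derivatives of the metric entries, which for `gPhi` are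
given by `xBlockDeriv`. -/
theorem christoffelAt_apply (g : (ι → ℝ) → Matrix ι ι ℝ) (P v w : ι → ℝ) (c : ι) :
    christoffelAt g P v w c = (1 / 2) * ∑ d, (g P)⁻¹ c d *
      (∑ b, fderiv ℝ (fun Q => g Q b d) P v * w b + ∑ a, fderiv ℝ (fun Q => g Q a d) P w * v a
        - ∑ a, ∑ b, fderiv ℝ (fun Q => g Q a b) P (Pi.single d 1) * v a * w b) := by
  simp only [christoffelAt, christoffel, Finset.mul_sum, Finset.sum_mul]
  have e1 : ∀ d, ∑ b, fderiv ℝ (fun Q => g Q b d) P v * w b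
      = ∑ a, ∑ b, partialDeriv a (fun Q => g Q b d) P * v a * w b := by
    intro d
    rw [Finset.sum_comm]
    exact Finset.sum_congr rfl fun b _ => by rw [fderiv_eq_sum_partialDeriv, Finset.sum_mul]
  have e2 : ∀ d, ∑ a, fderiv ℝ (fun Q => g Q a d) P w * v a
      = ∑ a, ∑ b, partialDeriv b (fun Q => g Q a d) P * v a * w b := by
    intro d
    refine Finset.sum_congr rfl fun b _ => ?_
    rw [fderiv_eq_sum_partialDeriv, Finset.sum_mul]
    exact Finset.sum_congr rfl fun b _ => by ring
  simp only [e1, e2, ← Finset.sum_add_distrib, ← Finset.sum_sub_distrib, Finset.mul_sum]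
  conv_rhs => rw [Finset.sum_comm]; enter [2, x]; rw [Finset.sum_comm]
  refine Finset.sum_congr rfl fun a _ => Finset.sum_congr rfl fun b _ =>
    Finset.sum_congr rfl fun d _ => ?_
  simp only [partialDeriv]
  ring

end Christoffel

/-- The inverse of `yBlock`. -/
noncomputable def yBlockInv (a b : Fin 4 × Fin 2) : ℝ :=
  if a.1 = b.1 then
    if a.1 = 3 then (if a.2 = b.2 then -(8 / 3) else -(4 / 3))
    else (if a.2 = b.2 then 0 else 1)
  else 0

/-- The inverse of `blockForm B`. -/
noncomputable def blockInv (B : Matrix (Fin 3) (Fin 3) ℝ) : Matrix Coord Coord ℝ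
  | Sum.inl i, Sum.inr (Sum.inl j) => if i = j then 1 else 0
  | Sum.inr (Sum.inl i), Sum.inl j => if i = j then 1 else 0
  | Sum.inr (Sum.inl i), Sum.inr (Sum.inl j) => -B i j
  | Sum.inr (Sum.inr a), Sum.inr (Sum.inr b) => yBlockInv a b
  | _, _ => 0

theorem sum_yBlock_mul_yBlockInv (a b : Fin 4 × Fin 2) :
    ∑ c, yBlock a c * yBlockInv c b = if a = b then 1 else 0 := by
  obtain ⟨a, a'⟩ := a
  obtain ⟨b, b'⟩ := b
  rw [Fintype.sum_prod_type, Finset.sum_eq_single a (fun c _ h => by simp [yBlock, Ne.symm h])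
    (by simp)]
  by_cases hab : a = b
  · subst hab
    by_cases h3 : a = 3
    · fin_cases a' <;> fin_cases b' <;> simp [yBlock, yBlockInv, h3] <;> norm_num
    · fin_cases a' <;> fin_cases b' <;> simp [yBlock, yBlockInv, h3]
  · simp [yBlock, yBlockInv, hab]

theorem blockForm_mul_blockInv (B : Matrix (Fin 3) (Fin 3) ℝ) : blockForm B * blockInv B = 1 := by
  ext a b
  rw [Matrix.mul_apply, Matrix.one_apply, Fintype.sum_sum_type, Fintype.sum_sum_type]
  rcases a with i | i | i <;> rcases b with j | j | j <;>
    simp [blockForm, blockInv, sum_yBlock_mul_yBlockInv]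

theorem inv_gPhi (φ : Fin 3 → Fin 2 → ℝ → ℝ) (P : Coord → ℝ) {B : Matrix (Fin 3) (Fin 3) ℝ}
    (h : gPhi φ P = blockForm B) : (gPhi φ P)⁻¹ = blockInv B := by
  rw [h]; exact Matrix.inv_eq_right_inv (blockForm_mul_blockInv B)

/-- The matrix of the components `g_Φ(∂_{x_i}, ∂_{x_j})`. -/
noncomputable def xBlock (φ : Fin 3 → Fin 2 → ℝ → ℝ) (p : Coord → ℝ) : Matrix (Fin 3) (Fin 3) ℝ :=
  !![-2 * φ 1 0 (p (X 1)) * p (Y 1 0) - 2 * φ 2 0 (p (X 2)) * p (Y 2 0), 0, p (X 1) * p (Y 3 1);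
    0, -2 * φ 2 1 (p (X 2)) * p (Y 2 1) - 2 * φ 0 1 (p (X 0)) * p (Y 0 1), p (X 0) * p (Y 3 0);
    p (X 1) * p (Y 3 1), p (X 0) * p (Y 3 0),
      -2 * φ 0 0 (p (X 0)) * p (Y 0 0) - 2 * φ 1 1 (p (X 1)) * p (Y 1 1)]

theorem gPhi_eq (φ : Fin 3 → Fin 2 → ℝ → ℝ) (p : Coord → ℝ) :
    gPhi φ p = blockForm (xBlock φ p) := rfl

/-- The derivative of `xBlock φ` at `p` in the direction `v`. -/
noncomputable def xBlockDeriv (φ : Fin 3 → Fin 2 → ℝ → ℝ) (p v : Coord → ℝ) :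
    Matrix (Fin 3) (Fin 3) ℝ :=
  !![-2 * (φ 1 0 (p (X 1)) * v (Y 1 0) + deriv (φ 1 0) (p (X 1)) * v (X 1) * p (Y 1 0))
      - 2 * (φ 2 0 (p (X 2)) * v (Y 2 0) + deriv (φ 2 0) (p (X 2)) * v (X 2) * p (Y 2 0)), 0,
      p (X 1) * v (Y 3 1) + v (X 1) * p (Y 3 1);
    0, -2 * (φ 2 1 (p (X 2)) * v (Y 2 1) + deriv (φ 2 1) (p (X 2)) * v (X 2) * p (Y 2 1))
      - 2 * (φ 0 1 (p (X 0)) * v (Y 0 1) + deriv (φ 0 1) (p (X 0)) * v (X 0) * p (Y 0 1)),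
      p (X 0) * v (Y 3 0) + v (X 0) * p (Y 3 0);
    p (X 1) * v (Y 3 1) + v (X 1) * p (Y 3 1), p (X 0) * v (Y 3 0) + v (X 0) * p (Y 3 0),
    -2 * (φ 0 0 (p (X 0)) * v (Y 0 0) + deriv (φ 0 0) (p (X 0)) * v (X 0) * p (Y 0 0))
      - 2 * (φ 1 1 (p (X 1)) * v (Y 1 1) + deriv (φ 1 1) (p (X 1)) * v (X 1) * p (Y 1 1))]

section Metric

variable {ι : Type}

theorem fderiv_coord_apply (a : ι) (P v : ι → ℝ) :
    fderiv ℝ (fun Q : ι → ℝ => Q a) P v = v a := by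
  rw [(hasFDerivAt_apply a P).fderiv]; rfl

theorem fderiv_comp_coord_apply [Fintype ι] {f : ℝ → ℝ} (hf : Differentiable ℝ f) (a : ι) (P v : ι → ℝ) :
    fderiv ℝ (fun Q : ι → ℝ => f (Q a)) P v = deriv f (P a) * v a := by
  have h : HasFDerivAt (fun Q : ι → ℝ => Q a) _ P := hasFDerivAt_apply (𝕜 := ℝ) a P
  have h' : HasFDerivAt (fun Q : ι → ℝ => f (Q a)) _ P :=
    (hf (P a)).hasDerivAt.comp_hasFDerivAt P h
  rw [h'.fderiv]; rfl

end Metric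

variable {φ : Fin 3 → Fin 2 → ℝ → ℝ}

theorem contDiff_xBlock (hφ : ∀ i j, ContDiff ℝ ∞ (φ i j)) (i j : Fin 3) :
    ContDiff ℝ ∞ fun p => xBlock φ p i j := by
  fin_cases i <;> fin_cases j <;> simp [xBlock] <;> fun_prop

theorem fderiv_xBlock (hφ : ∀ i j, ContDiff ℝ ∞ (φ i j)) (i j : Fin 3) (P v : Coord → ℝ) :
    fderiv ℝ (fun p => xBlock φ p i j) P v = xBlockDeriv φ P v i j := by
  have hd : ∀ i j, Differentiable ℝ (φ i j) := fun i j => (hφ i j).differentiable (by simp)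
  fin_cases i <;> fin_cases j <;>
    simp (disch := fun_prop) [xBlock, xBlockDeriv, fderiv_fun_mul, fderiv_fun_sub,
      fderiv_coord_apply, fderiv_comp_coord_apply] <;> ring

theorem yBlock_comm (a b : Fin 4 × Fin 2) : yBlock a b = yBlock b a := by
  obtain ⟨i, i'⟩ := a
  obtain ⟨j, j'⟩ := b
  by_cases hij : i = j
  · subst hij
    simp only [yBlock, eq_comm]
  · simp [yBlock, hij, Ne.symm hij]

theorem xBlock_symm (φ : Fin 3 → Fin 2 → ℝ → ℝ) (P : Coord → ℝ) (i j : Fin 3) :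
    xBlock φ P i j = xBlock φ P j i := by
  fin_cases i <;> fin_cases j <;> rfl

theorem isPseudoRiemannian_gPhi (hφ : ∀ i j, ContDiff ℝ ∞ (φ i j)) :
    IsPseudoRiemannian (gPhi φ) := by
  refine ⟨fun a b => ?_, fun P => ⟨?_, ?_⟩⟩
  · simp only [gPhi_eq]
    rcases a with i | i | i <;> rcases b with j | j | j <;>
      first
      | exact contDiff_xBlock hφ i j
      | exact contDiff_const
  · rw [gPhi_eq]
    refine Matrix.IsSymm.ext fun a b => ?_
    rcases a with i | i | i <;> rcases b with j | j | j <;> simp only [blockForm]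
    · exact xBlock_symm φ P j i
    · simp only [eq_comm]
    · simp only [eq_comm]
    · exact yBlock_comm j i
  · rw [gPhi_eq]
    exact Matrix.det_ne_zero_of_right_inverse (blockForm_mul_blockInv _)

/-- The components of `Γ(v, w)` for the metric `gPhi φ` at `p`. -/
noncomputable def gammaPhi (φ : Fin 3 → Fin 2 → ℝ → ℝ) (p v w : Coord → ℝ) : Coord → ℝ
  | Sum.inl _ => 0
  | Sum.inr (Sum.inl k) => (1 / 2) * (∑ j, xBlockDeriv φ p v j k * w (X j)
      + ∑ j, xBlockDeriv φ p w j k * v (X j)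
      - ![-2 * deriv (φ 0 1) (p (X 0)) * p (Y 0 1) * v (X 1) * w (X 1)
            - 2 * deriv (φ 0 0) (p (X 0)) * p (Y 0 0) * v (X 2) * w (X 2)
            + p (Y 3 0) * (v (X 1) * w (X 2) + v (X 2) * w (X 1)),
          -2 * deriv (φ 1 0) (p (X 1)) * p (Y 1 0) * v (X 0) * w (X 0)
            - 2 * deriv (φ 1 1) (p (X 1)) * p (Y 1 1) * v (X 2) * w (X 2)
            + p (Y 3 1) * (v (X 0) * w (X 2) + v (X 2) * w (X 0)),
          -2 * deriv (φ 2 0) (p (X 2)) * p (Y 2 0) * v (X 0) * w (X 0)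
            - 2 * deriv (φ 2 1) (p (X 2)) * p (Y 2 1) * v (X 1) * w (X 1)] k)
  | Sum.inr (Sum.inr (i, j)) =>
    -- Raising the index exchanges `y_{i,1}` and `y_{i,2}` for `i ≤ 3`. For `i = 4` the factors 4/3
    -- and 2/3 are -1/2 times the entries -8/3 and -4/3 of `yBlockInv`.
    !![φ 0 1 (p (X 0)) * v (X 1) * w (X 1), φ 0 0 (p (X 0)) * v (X 2) * w (X 2);
      φ 1 1 (p (X 1)) * v (X 2) * w (X 2), φ 1 0 (p (X 1)) * v (X 0) * w (X 0);
      φ 2 1 (p (X 2)) * v (X 1) * w (X 1), φ 2 0 (p (X 2)) * v (X 0) * w (X 0);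
      (4 / 3) * p (X 0) * (v (X 1) * w (X 2) + v (X 2) * w (X 1))
        + (2 / 3) * p (X 1) * (v (X 0) * w (X 2) + v (X 2) * w (X 0)),
      (2 / 3) * p (X 0) * (v (X 1) * w (X 2) + v (X 2) * w (X 1))
        + (4 / 3) * p (X 1) * (v (X 0) * w (X 2) + v (X 2) * w (X 0))] i j

theorem fderiv_gPhi (hφ : ∀ i j, ContDiff ℝ ∞ (φ i j)) (a b : Coord) (P v : Coord → ℝ) :
    fderiv ℝ (fun Q => gPhi φ Q a b) P v = match a, b with
      | Sum.inl i, Sum.inl j => xBlockDeriv φ P v i j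
      | _, _ => 0 := by
  rcases a with i | i | i <;> rcases b with j | j | j <;> simp only [gPhi_eq, blockForm] <;>
    first
    | exact fderiv_xBlock hφ i j P v
    | simp

theorem sum_yBlockInv_mul (i : Fin 4) (j : Fin 2) (f : Fin 4 × Fin 2 → ℝ) :
    ∑ c, yBlockInv (i, j) c * f c
      = if i = 3 then -(8 / 3) * f (3, j) - (4 / 3) * f (3, 1 - j) else f (i, 1 - j) := by
  rw [Fintype.sum_prod_type, Finset.sum_eq_single i (fun c _ h => by simp [yBlockInv, Ne.symm h])
    (by simp)]
  by_cases h3 : i = 3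
  · fin_cases j <;> simp [yBlockInv, h3] <;> ring
  · fin_cases j <;> simp [yBlockInv, h3]

/-- The `x`-components vanish because row `x_k` of the inverse meets only column `x_k^*`, while no
metric entry depends on `x*` and those involving `∂_{x_k^*}` are constant. -/
theorem christoffelAt_gPhi (hφ : ∀ i j, ContDiff ℝ ∞ (φ i j)) (P v w : Coord → ℝ) :
    christoffelAt (gPhi φ) P v w = gammaPhi φ P v w := by
  funext c
  rw [christoffelAt_apply]
  simp only [fderiv_gPhi hφ, inv_gPhi φ P (gPhi_eq φ P), Fintype.sum_sum_type]
  rcases c with k | k | ⟨i, j⟩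
  · have : xBlockDeriv φ P (Pi.single (XS k) 1) = 0 := by
      ext i j
      fin_cases i <;> fin_cases j <;> simp [xBlockDeriv]
    simp [blockInv, gammaPhi, this]
  · have : ∀ j, xBlockDeriv φ P (Pi.single (XS j) 1) = 0 := by
      intro k
      ext i j
      fin_cases i <;> fin_cases j <;> simp [xBlockDeriv]
    simp only [blockInv, gammaPhi, this]
    fin_cases k <;> simp [xBlockDeriv, Fin.sum_univ_three] <;> ring
  · simp only [blockInv, gammaPhi, zero_mul, Finset.sum_const_zero, zero_add, sum_yBlockInv_mul]
    fin_cases i <;> fin_cases j <;> simp [xBlockDeriv, Fin.sum_univ_three] <;> ring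

/-! ### Curvature formula and the triangular geodesic equation -/

section Curvature

variable {ι : Type} [Fintype ι] [DecidableEq ι]

theorem curvatureAt_eq (g : (ι → ℝ) → Matrix ι ι ℝ) (P x y z : ι → ℝ) :
    curvatureAt g P x y z =
      fderiv ℝ (fun Q => christoffelAt g Q y z) P x + christoffelAt g P x (christoffelAt g P y z)
      - (fderiv ℝ (fun Q => christoffelAt g Q x z) P y
        + christoffelAt g P y (christoffelAt g P x z)) := by
  have h0 : ∀ w : ι → ℝ, christoffelAt g P 0 w = 0 := fun w => by
    funext c; simp [christoffelAt]
  have h1 : ∀ u w : ι → ℝ,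
      nabla g (fun _ => u) (fun _ => w) = fun Q => christoffelAt g Q u w := fun u w => by
    funext Q; simp [nabla]
  simp only [curvatureAt, curvature, h1]
  simp [nabla, VectorField.lieBracket, h0]

end Curvature

/-- The level of a coordinate in the triangular geodesic equation. -/
def level : Coord → ℕ
  | Sum.inl _ => 0
  | Sum.inr (Sum.inl _) => 2
  | Sum.inr (Sum.inr _) => 1

theorem contDiff_deriv_phi (hφ : ∀ i j, ContDiff ℝ ∞ (φ i j)) (i : Fin 3) (j : Fin 2) :
    ContDiff ℝ ∞ (deriv (φ i j)) := (contDiff_infty_iff_deriv.1 (hφ i j)).2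

theorem contDiff_gammaPhi (hφ : ∀ i j, ContDiff ℝ ∞ (φ i j)) :
    ContDiff ℝ ∞ fun p : (Coord → ℝ) × (Coord → ℝ) × (Coord → ℝ) =>
      gammaPhi φ p.1 p.2.1 p.2.2 := by
  have hφ' := contDiff_deriv_phi hφ
  refine contDiff_pi.2 fun c => ?_
  rcases c with k | k | ⟨i, j⟩
  · exact contDiff_const
  · fin_cases k <;> simp [gammaPhi, xBlockDeriv, Fin.sum_univ_three] <;> fun_prop
  · fin_cases i <;> fin_cases j <;> simp [gammaPhi] <;> fun_prop

theorem isTriangular_gammaPhi (φ : Fin 3 → Fin 2 → ℝ → ℝ) :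
    IsTriangular level fun p => -gammaPhi φ p.1 p.2 p.2 := by
  intro p q c h1 h2
  simp only [Pi.neg_apply, neg_inj]
  rcases c with k | k | ⟨i, j⟩
  · rfl
  · have a1 : ∀ i, p.1 (X i) = q.1 (X i) := fun i => h1 _ (by simp [level])
    have a2 : ∀ i, p.2 (X i) = q.2 (X i) := fun i => h2 _ (by simp [level])
    have b1 : ∀ i j, p.1 (Y i j) = q.1 (Y i j) := fun i j => h1 _ (by simp [level])
    have b2 : ∀ i j, p.2 (Y i j) = q.2 (Y i j) := fun i j => h2 _ (by simp [level])
    simp only [gammaPhi, xBlockDeriv, a1, a2, b1, b2]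
  · have a1 : ∀ i, p.1 (X i) = q.1 (X i) := fun i => h1 _ (by simp [level])
    have a2 : ∀ i, p.2 (X i) = q.2 (X i) := fun i => h2 _ (by simp [level])
    simp only [gammaPhi, a1, a2]

theorem geodesic_system_gPhi (hφ : ∀ i j, ContDiff ℝ ∞ (φ i j)) :
    (ContDiff ℝ ∞ fun p : (Coord → ℝ) × (Coord → ℝ) => -christoffelAt (gPhi φ) p.1 p.2 p.2) ∧
    IsTriangular level fun p => -christoffelAt (gPhi φ) p.1 p.2 p.2 := by
  simp only [christoffelAt_gPhi hφ]
  exact ⟨((contDiff_gammaPhi hφ).comp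
    (contDiff_fst.prodMk (contDiff_snd.prodMk contDiff_snd))).neg, isTriangular_gammaPhi φ⟩

theorem curvatureAt_gPhi_apply (hφ : ∀ i j, ContDiff ℝ ∞ (φ i j)) (P x y z : Coord → ℝ)
    (c : Coord) :
    curvatureAt (gPhi φ) P x y z c =
      fderiv ℝ (fun Q => gammaPhi φ Q y z c) P x + gammaPhi φ P x (gammaPhi φ P y z) c
      - (fderiv ℝ (fun Q => gammaPhi φ Q x z c) P y
        + gammaPhi φ P y (gammaPhi φ P x z) c) := by
  have hd : ∀ v w : Coord → ℝ, DifferentiableAt ℝ (fun Q => gammaPhi φ Q v w) P := by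
    intro v w
    have hs : ContDiff ℝ ∞ fun Q : Coord → ℝ => (Q, v, w) := contDiff_id.prodMk contDiff_const
    have h := ((contDiff_gammaPhi hφ).comp hs).differentiable (by simp)
    exact h P
  rw [curvatureAt_eq]
  simp only [christoffelAt_gPhi hφ, Pi.add_apply, Pi.sub_apply]
  have hc : ∀ v w u : Coord → ℝ, fderiv ℝ (fun Q => gammaPhi φ Q v w) P u c
      = fderiv ℝ (fun Q => gammaPhi φ Q v w c) P u := fun v w u => by
    have h := hasFDerivAt_pi'.1 (hd v w).hasFDerivAt c
    rw [h.fderiv]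
    rfl
  rw [hc, hc]

/-! ### The curvature tensor of the metric -/

theorem curvatureAt_gPhi_X (hφ : ∀ i j, ContDiff ℝ ∞ (φ i j)) (P x y z : Coord → ℝ)
    (k : Fin 3) : curvatureAt (gPhi φ) P x y z (X k) = 0 := by
  rw [curvatureAt_gPhi_apply hφ]
  simp [gammaPhi]

/-- The components of type `R(x, y, z, ∂_{y_{i,j}})`, with factors `s i j`. -/
noncomputable def curvCov (s : Fin 3 → Fin 2 → ℝ) (x y z : Coord → ℝ) : Matrix (Fin 4) (Fin 2) ℝ :=
  let m := fun i j => x (X i) * y (X j) - x (X j) * y (X i)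
  !![s 0 0 * (m 0 2 * z (X 2)), s 0 1 * (m 0 1 * z (X 1));
    s 1 0 * (m 1 0 * z (X 0)), s 1 1 * (m 1 2 * z (X 2));
    s 2 0 * (m 2 0 * z (X 0)), s 2 1 * (m 2 1 * z (X 1));
    -(1 / 2) * (m 0 1 * z (X 2) + m 0 2 * z (X 1)),
    -(1 / 2) * (m 1 2 * z (X 0) + m 1 0 * z (X 2))]

theorem curvatureAt_gPhi_Y (hφ : ∀ i j, ContDiff ℝ ∞ (φ i j)) (P x y z : Coord → ℝ)
    (i : Fin 4) (j : Fin 2) : curvatureAt (gPhi φ) P x y z (Y i j) =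
      ∑ b, yBlockInv (i, j) b * curvCov (fun i j => deriv (φ i j) (P (X i))) x y z b.1 b.2 := by
  have hd : ∀ i j, Differentiable ℝ (φ i j) := fun i j => (hφ i j).differentiable (by simp)
  rw [curvatureAt_gPhi_apply hφ, sum_yBlockInv_mul]
  fin_cases i <;> fin_cases j <;>
    simp (disch := fun_prop) [gammaPhi, curvCov, fderiv_const_mul, fderiv_mul_const,
      fderiv_fun_add, fderiv_coord_apply, fderiv_comp_coord_apply] <;> ring

/-- The pairing of `curvCov s x y z` with the `y`-components of `w`. -/
noncomputable def curvPair (s : Fin 3 → Fin 2 → ℝ) (x y z w : Coord → ℝ) : ℝ :=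
  ∑ i, ∑ j, curvCov s x y z i j * w (Y i j)

/-- The algebraic curvature tensor generated by `curvPair s`. -/
noncomputable def curvTensor (s : Fin 3 → Fin 2 → ℝ) (x y z w : Coord → ℝ) : ℝ :=
  curvPair s x y z w - curvPair s x y w z + curvPair s z w x y - curvPair s z w y x

/-- The components `R(∂_{x_1}, ∂_{x_2}, ∂_{x_2}, ∂_{x_1})`, `R(∂_{x_1}, ∂_{x_3}, ∂_{x_3}, ∂_{x_1})`,
`R(∂_{x_2}, ∂_{x_3}, ∂_{x_3}, ∂_{x_2})` and `R(∂_{x_1}, ∂_{x_3}, ∂_{x_2}, ∂_{x_3})`. -/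
noncomputable def xCurv (φ : Fin 3 → Fin 2 → ℝ → ℝ) (P : Coord → ℝ) : Fin 4 → ℝ :=
  ![deriv (deriv (φ 0 1)) (P (X 0)) * P (Y 0 1) + deriv (deriv (φ 1 0)) (P (X 1)) * P (Y 1 0)
      - φ 2 0 (P (X 2)) * φ 2 1 (P (X 2)),
    deriv (deriv (φ 0 0)) (P (X 0)) * P (Y 0 0) + deriv (deriv (φ 2 0)) (P (X 2)) * P (Y 2 0)
      - φ 1 0 (P (X 1)) * φ 1 1 (P (X 1)) - (2 / 3) * P (X 1) ^ 2,
    deriv (deriv (φ 2 1)) (P (X 2)) * P (Y 2 1) + deriv (deriv (φ 1 1)) (P (X 1)) * P (Y 1 1)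
      - φ 0 0 (P (X 0)) * φ 0 1 (P (X 0)) - (2 / 3) * P (X 0) ^ 2,
    (1 / 3) * P (X 0) * P (X 1)]

/-- The part of the curvature tensor that only involves the `x`-components. -/
noncomputable def xCurvTensor (q : Fin 4 → ℝ) (x y z w : Coord → ℝ) : ℝ :=
  let m := fun i j => x (X i) * y (X j) - x (X j) * y (X i)
  let n := fun i j => z (X i) * w (X j) - z (X j) * w (X i)
  q 3 * (m 0 2 * n 1 2 + m 1 2 * n 0 2)
    - q 0 * m 0 1 * n 0 1 - q 1 * m 0 2 * n 0 2 - q 2 * m 1 2 * n 1 2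

set_option maxHeartbeats 2000000 in
theorem sum_curvatureAt_gPhi_XS (hφ : ∀ i j, ContDiff ℝ ∞ (φ i j)) (P x y z w : Coord → ℝ) :
    ∑ k, curvatureAt (gPhi φ) P x y z (XS k) * w (X k) =
      - curvPair (fun i j => deriv (φ i j) (P (X i))) x y w z
      + curvPair (fun i j => deriv (φ i j) (P (X i))) z w x y
      - curvPair (fun i j => deriv (φ i j) (P (X i))) z w y x
      + xCurvTensor (xCurv φ P) x y z w := by
  have hd : ∀ i j, Differentiable ℝ (φ i j) := fun i j => (hφ i j).differentiable (by simp)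
  have hd' : ∀ i j, Differentiable ℝ (deriv (φ i j)) := fun i j =>
    (contDiff_deriv_phi hφ i j).differentiable (by simp)
  simp only [curvatureAt_gPhi_apply hφ, Fin.sum_univ_three]
  simp (disch := fun_prop) [gammaPhi, xBlockDeriv, Fin.sum_univ_three, fderiv_fun_mul,
      fderiv_fun_sub, fderiv_fun_neg,
      fderiv_fun_add, fderiv_coord_apply, fderiv_comp_coord_apply]
  simp [curvPair, curvCov, xCurvTensor, xCurv, Fin.sum_univ_succ]
  ring

theorem toBilin'_blockForm (B : Matrix (Fin 3) (Fin 3) ℝ) (v w : Coord → ℝ) :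
    Matrix.toBilin' (blockForm B) v w = ∑ i, ∑ j, B i j * v (X i) * w (X j)
      + ∑ k, (v (X k) * w (XS k) + v (XS k) * w (X k))
      + ∑ a, ∑ b, yBlock a b * v (Y a.1 a.2) * w (Y b.1 b.2) := by
  rw [Matrix.toBilin'_apply]
  simp only [Fintype.sum_sum_type, blockForm]
  simp [Finset.sum_add_distrib, mul_comm]
  ring

theorem sum_yBlock_mul_sum_yBlockInv_mul (b : Fin 4 × Fin 2) (f : Fin 4 × Fin 2 → ℝ) :
    ∑ a, yBlock a b * ∑ c, yBlockInv a c * f c = f b := by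
  simp only [Finset.mul_sum, ← mul_assoc]
  rw [Finset.sum_comm]
  simp only [← Finset.sum_mul, yBlock_comm _ b, sum_yBlock_mul_yBlockInv]
  simp

/-- As `R(x,y)z` has no `x`-components, the `x`-block of the metric drops out: lowering the index
pairs its `x*`-components with the `x`-components of `w`, and `yBlock` cancels `yBlockInv`. -/
theorem modelAt_gPhi_curv (hφ : ∀ i j, ContDiff ℝ ∞ (φ i j)) (P x y z w : Coord → ℝ) :
    (modelAt (gPhi φ) P).curv x y z w =
      curvTensor (fun i j => deriv (φ i j) (P (X i))) x y z w
        + xCurvTensor (xCurv φ P) x y z w := by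
  have h : (modelAt (gPhi φ) P).curv x y z w
      = ∑ k, curvatureAt (gPhi φ) P x y z (XS k) * w (X k)
        + curvPair (fun i j => deriv (φ i j) (P (X i))) x y z w := by
    simp only [modelAt, gPhi_eq, toBilin'_blockForm]
    simp only [curvatureAt_gPhi_X hφ, curvatureAt_gPhi_Y hφ]
    rw [Finset.sum_comm (γ := Fin 4 × Fin 2)]
    simp only [← Finset.sum_mul, Prod.mk.eta, sum_yBlock_mul_sum_yBlockInv_mul, curvPair]
    simp [Fintype.sum_prod_type]
  rw [h, sum_curvatureAt_gPhi_XS hφ, curvTensor]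
  ring

/-! ### The model tensor and its symmetries -/

theorem sum_component (x y z : Coord → ℝ) (l : Fin 4) (m : Fin 2) :
    ∑ i, ∑ j, ∑ k, component i j k l m * x (X i) * y (X j) * z (X k) = curvCov 1 x y z l m := by
  fin_cases l <;> fin_cases m <;>
    simp [Fin.sum_univ_three, component, listedComponent, curvCov] <;> ring

theorem sum_comm_pairs {α β : Type*} [Fintype α] [Fintype β] (f : α → α → α → β → ℝ) :
    ∑ k, ∑ b, ∑ i, ∑ j, f i j k b = ∑ i, ∑ j, ∑ k, ∑ b, f i j k b := by
  calc ∑ k, ∑ b, ∑ i, ∑ j, f i j k b = ∑ k, ∑ i, ∑ b, ∑ j, f i j k b :=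
        Finset.sum_congr rfl fun _ _ => Finset.sum_comm
    _ = ∑ i, ∑ k, ∑ b, ∑ j, f i j k b := Finset.sum_comm
    _ = ∑ i, ∑ k, ∑ j, ∑ b, f i j k b :=
        Finset.sum_congr rfl fun _ _ => Finset.sum_congr rfl fun _ _ => Finset.sum_comm
    _ = _ := Finset.sum_congr rfl fun _ _ => Finset.sum_comm

theorem curvPair_one (x y z w : Coord → ℝ) :
    curvPair 1 x y z w = ∑ i, ∑ j, ∑ k, ∑ b : Fin 4 × Fin 2,
      component i j k b.1 b.2 * x (X i) * y (X j) * z (X k) * w (Y b.1 b.2) := by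
  rw [← sum_comm_pairs, Finset.sum_comm]
  rw [Fintype.sum_prod_type]
  simp only [curvPair, ← sum_component, Finset.sum_mul]
  refine Finset.sum_congr rfl fun l _ => Finset.sum_congr rfl fun m _ => ?_
  conv_rhs => rw [Finset.sum_comm]; enter [2, i]; rw [Finset.sum_comm]

theorem model14_curv (x y z w : Coord → ℝ) : model14.curv x y z w = curvTensor 1 x y z w := by
  simp only [model14, Fintype.sum_sum_type, modelCurv, zero_mul, Finset.sum_const_zero, add_zero,
    zero_add, curvTensor, curvPair_one]
  simp only [Finset.sum_add_distrib, sub_eq_add_neg, ← Finset.sum_neg_distrib]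
  congr 1
  · congr 1
    · congr 1
      refine Finset.sum_congr rfl fun i _ => Finset.sum_congr rfl fun j _ => ?_
      rw [Finset.sum_comm]
      refine Finset.sum_congr rfl fun k _ => Finset.sum_congr rfl fun b _ => ?_
      ring
    · rw [← sum_comm_pairs]
      refine Finset.sum_congr rfl fun k _ => Finset.sum_congr rfl fun b _ =>
        Finset.sum_congr rfl fun i _ => Finset.sum_congr rfl fun j _ => ?_
      ring
  · rw [← sum_comm_pairs, Finset.sum_comm (γ := Fin 4 × Fin 2)]
    refine Finset.sum_congr rfl fun k _ => Finset.sum_congr rfl fun b _ =>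
        Finset.sum_congr rfl fun i _ => Finset.sum_congr rfl fun j _ => ?_
    ring

/-- This and `curvPair_cyclic` are all that the curvature identities need, pair symmetry being built
into `curvTensor`. -/
theorem curvPair_swap (s : Fin 3 → Fin 2 → ℝ) (x y z w : Coord → ℝ) :
    curvPair s y x z w = -curvPair s x y z w := by
  simp [curvPair, curvCov, Fin.sum_univ_succ]
  ring

theorem curvPair_cyclic (s : Fin 3 → Fin 2 → ℝ) (x y z w : Coord → ℝ) :
    curvPair s x y z w + curvPair s y z x w + curvPair s z x y w = 0 := by
  simp [curvPair, curvCov, Fin.sum_univ_succ]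
  ring

theorem toBilin'_eq_zero {ι : Type} [Fintype ι] [DecidableEq ι] {M : Matrix ι ι ℝ}
    (hM : M.det ≠ 0) (v : ι → ℝ) (h : ∀ w, Matrix.toBilin' M v w = 0) : v = 0 :=
  (LinearMap.BilinForm.nondegenerate_toBilin'_of_det_ne_zero' M hM).1 v h

theorem sum_modelCurv_eq (v : Fin 4 → Coord → ℝ) :
    (∑ a, ∑ b, ∑ c, ∑ d, modelCurv a b c d •
      (MultilinearMap.mkPiAlgebra ℝ (Fin 4) ℝ).compLinearMap
        (fun i => LinearMap.proj (![a, b, c, d] i))) v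
      = ∑ a, ∑ b, ∑ c, ∑ d, modelCurv a b c d * v 0 a * v 1 b * v 2 c * v 3 d := by
  simp only [sum_apply, smul_apply, MultilinearMap.compLinearMap_apply,
    MultilinearMap.mkPiAlgebra_apply, LinearMap.proj_apply, Fin.prod_univ_four, smul_eq_mul]
  refine Finset.sum_congr rfl fun a _ => Finset.sum_congr rfl fun b _ =>
    Finset.sum_congr rfl fun c _ => Finset.sum_congr rfl fun d _ => ?_
  simp only [mul_assoc]
  rfl

theorem model14_form_symm (v w : Coord → ℝ) : model14.form v w = model14.form w v := by
  simp only [model14, toBilin'_blockForm]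
  congr 1
  · simp [mul_comm, add_comm]
  · rw [Finset.sum_comm]
    refine Finset.sum_congr rfl fun b _ => Finset.sum_congr rfl fun a _ => ?_
    rw [yBlock_comm, mul_right_comm]

theorem model14_isZeroModel : model14.IsZeroModel where
  form_symm := model14_form_symm
  form_nondegenerate :=
    toBilin'_eq_zero (Matrix.det_ne_zero_of_right_inverse (blockForm_mul_blockInv 0))
  -- The witness is the combination of products of coordinate functionals in `sum_modelCurv_eq`.
  curv_multilinear := ⟨_, fun v₁ v₂ v₃ v₄ => (sum_modelCurv_eq ![v₁, v₂, v₃, v₄]).symm⟩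
  curv_skew v₁ v₂ v₃ v₄ := by
    simp only [model14_curv, curvTensor]
    linarith [curvPair_swap 1 v₁ v₂ v₃ v₄, curvPair_swap 1 v₁ v₂ v₄ v₃]
  curv_pair v₁ v₂ v₃ v₄ := by
    simp only [model14_curv, curvTensor]
    ring
  curv_bianchi v₁ v₂ v₃ v₄ := by
    simp only [model14_curv, curvTensor]
    linarith [curvPair_cyclic 1 v₁ v₂ v₃ v₄, curvPair_cyclic 1 v₂ v₃ v₄ v₁,
      curvPair_cyclic 1 v₃ v₁ v₄ v₂, curvPair_cyclic 1 v₁ v₂ v₄ v₃,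
      curvPair_swap 1 v₂ v₄ v₃ v₁, curvPair_swap 1 v₃ v₄ v₁ v₂, curvPair_swap 1 v₁ v₄ v₂ v₃]

/-! ### The isomorphism with the model -/

/-- A model with non-degenerate form which embeds in a 0-model of the same dimension is a 0-model
isomorphic to it. -/
theorem isZeroModel_and_isIsomorphic_of_linearMap {V : Type} [AddCommGroup V] [Module ℝ V]
    [FiniteDimensional ℝ V] {M N : ModelData V} (hN : N.IsZeroModel)
    (hM : ∀ v, (∀ w, M.form v w = 0) → v = 0) (Θ : V →ₗ[ℝ] V)
    (hform : ∀ v w, N.form (Θ v) (Θ w) = M.form v w)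
    (hcurv : ∀ v₁ v₂ v₃ v₄, N.curv (Θ v₁) (Θ v₂) (Θ v₃) (Θ v₄) = M.curv v₁ v₂ v₃ v₄) :
    M.IsZeroModel ∧ M.IsIsomorphic N := by
  refine ⟨⟨?_, hM, ?_, ?_, ?_, ?_⟩, ?_⟩
  · intro v w
    rw [← hform, ← hform, hN.form_symm]
  · obtain ⟨T, hT⟩ := hN.curv_multilinear
    refine ⟨T.compLinearMap fun _ => Θ, fun v₁ v₂ v₃ v₄ => ?_⟩
    rw [← hcurv, hT, MultilinearMap.compLinearMap_apply]
    congr 1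
    funext i
    fin_cases i <;> rfl
  · intro v₁ v₂ v₃ v₄
    simp only [← hcurv]
    exact hN.curv_skew _ _ _ _
  · intro v₁ v₂ v₃ v₄
    simp only [← hcurv]
    exact hN.curv_pair _ _ _ _
  · intro v₁ v₂ v₃ v₄
    simp only [← hcurv]
    exact hN.curv_bianchi _ _ _ _
  · have hinj : Function.Injective Θ := by
      rw [injective_iff_map_eq_zero]
      intro v hv
      refine hM v fun w => ?_
      rw [← hform, hv]
      simp
    exact ⟨LinearEquiv.ofInjectiveEndo Θ hinj, hform, hcurv⟩

/-- The `y`-components of the frame vectors which remove `xCurvTensor q`, contracted with `v`. -/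
noncomputable def frameShift (q : Fin 4 → ℝ) (v : Coord → ℝ) : Fin 4 → Fin 2 → ℝ :=
  ![![q 1 / 2 * v (X 0) - q 3 * v (X 1), q 0 / 2 * v (X 0)], ![0, q 2 / 2 * v (X 1)], 0, 0]

/-- The factors by which the `y`-directions are rescaled. -/
def frameScale (s : Fin 3 → Fin 2 → ℝ) : Fin 4 → Fin 2 → ℝ := ![s 0, s 1, s 2, 1]

/-- The isomorphism from the tangent space, with `x`-block `B` of the metric, onto the model. -/
noncomputable def frameMap (B : Matrix (Fin 3) (Fin 3) ℝ) (s : Fin 3 → Fin 2 → ℝ) (q : Fin 4 → ℝ)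
    (v : Coord → ℝ) : Coord → ℝ
  | Sum.inl i => v (X i)
  -- `B` is shared equally between the two arguments of the form. The subtracted vector cancels the
  -- products of the shift with the rescaled `y`-parts and, again in equal halves, of the shift with
  -- itself.
  | Sum.inr (Sum.inl k) => v (XS k) + (1 / 2) * ∑ i, B i k * v (X i)
      - ![q 1 / 2 * (s 0 1 * v (Y 0 1)) + q 0 / 2 * (s 0 0 * v (Y 0 0))
            + q 0 * q 1 / 4 * v (X 0) - q 0 * q 3 / 4 * v (X 1),
          -q 3 * (s 0 1 * v (Y 0 1)) + q 2 / 2 * (s 1 0 * v (Y 1 0)) - q 0 * q 3 / 4 * v (X 0),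
          0] k
  | Sum.inr (Sum.inr (i, j)) => frameScale s i j * v (Y i j) + frameShift q v i j

/-- `frameMap` as a linear map. -/
noncomputable def frameLinearMap (B : Matrix (Fin 3) (Fin 3) ℝ) (s : Fin 3 → Fin 2 → ℝ)
    (q : Fin 4 → ℝ) : (Coord → ℝ) →ₗ[ℝ] (Coord → ℝ) where
  toFun := frameMap B s q
  map_add' v w := by
    funext c
    rcases c with i | k | ⟨i, j⟩
    · rfl
    · fin_cases k <;> simp [frameMap, Fin.sum_univ_three] <;> ring
    · fin_cases i <;> fin_cases j <;> simp [frameMap, frameShift] <;> ring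
  map_smul' c v := by
    funext c
    rcases c with i | k | ⟨i, j⟩
    · rfl
    · fin_cases k <;> simp [frameMap, Fin.sum_univ_three] <;> ring
    · fin_cases i <;> fin_cases j <;> simp [frameMap, frameShift] <;> ring

theorem frameLinearMap_apply (B : Matrix (Fin 3) (Fin 3) ℝ) (s : Fin 3 → Fin 2 → ℝ)
    (q : Fin 4 → ℝ) (v : Coord → ℝ) : frameLinearMap B s q v = frameMap B s q v := rfl

theorem form_frameMap {B : Matrix (Fin 3) (Fin 3) ℝ} (hB : ∀ i j, B i j = B j i)
    {s : Fin 3 → Fin 2 → ℝ} (hs : ∀ i, s i 0 * s i 1 = 1) (q : Fin 4 → ℝ) (v w : Coord → ℝ) :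
    Matrix.toBilin' (blockForm 0) (frameMap B s q v) (frameMap B s q w)
      = Matrix.toBilin' (blockForm B) v w := by
  have e : ∀ u u' : Fin 4 → Fin 2 → ℝ,
      ∑ a : Fin 4 × Fin 2, ∑ b : Fin 4 × Fin 2, yBlock a b * u a.1 a.2 * u' b.1 b.2
      = u 0 0 * u' 0 1 + u 0 1 * u' 0 0 + u 1 0 * u' 1 1 + u 1 1 * u' 1 0
        + u 2 0 * u' 2 1 + u 2 1 * u' 2 0 - (1 / 2) * (u 3 0 * u' 3 0 + u 3 1 * u' 3 1)
        + (1 / 4) * (u 3 0 * u' 3 1 + u 3 1 * u' 3 0) := by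
    intro u u'
    simp only [Fintype.sum_prod_type]
    simp [yBlock, Fin.sum_univ_four]
    ring
  rw [toBilin'_blockForm, toBilin'_blockForm, e (fun i j => frameMap B s q v (Y i j))
    (fun i j => frameMap B s q w (Y i j)), e (fun i j => v (Y i j)) (fun i j => w (Y i j))]
  simp [Fin.sum_univ_three, frameMap, frameShift, frameScale]
  rw [hB 1 0, hB 2 0, hB 2 1]
  linear_combination (v (Y 0 0) * w (Y 0 1) + v (Y 0 1) * w (Y 0 0)) * hs 0
    + (v (Y 1 0) * w (Y 1 1) + v (Y 1 1) * w (Y 1 0)) * hs 1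
    + (v (Y 2 0) * w (Y 2 1) + v (Y 2 1) * w (Y 2 0)) * hs 2

/-- The frame map fixes `x`-components, so only the `y`-slot of `curvPair` changes: its rescaling
yields `curvTensor s`, its shift `xCurvTensor q`. -/
theorem curvTensor_frameMap (B : Matrix (Fin 3) (Fin 3) ℝ) (s : Fin 3 → Fin 2 → ℝ) (q : Fin 4 → ℝ)
    (x y z w : Coord → ℝ) :
    curvTensor 1 (frameMap B s q x) (frameMap B s q y) (frameMap B s q z) (frameMap B s q w)
      = curvTensor s x y z w + xCurvTensor q x y z w := by
  have e : ∀ x y z w : Coord → ℝ, curvPair 1 (frameMap B s q x) (frameMap B s q y)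
      (frameMap B s q z) (frameMap B s q w) = curvPair s x y z w
        + ∑ i, ∑ j, curvCov 1 x y z i j * frameShift q w i j := by
    intro x y z w
    simp [curvPair, curvCov, frameMap, frameScale, Fin.sum_univ_succ]
    ring
  simp only [curvTensor, e]
  simp [xCurvTensor, frameShift, curvCov, Fin.sum_univ_succ]
  ring

theorem hasZeroModel_gPhi (hφ : ∀ i j, ContDiff ℝ ∞ (φ i j))
    (hφ' : ∀ i t, deriv (φ i 0) t * deriv (φ i 1) t = 1) : HasZeroModel (gPhi φ) model14 := by
  intro P
  have hdet := ((isPseudoRiemannian_gPhi hφ).2 P).2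
  have hM : ∀ v, (∀ w, (modelAt (gPhi φ) P).form v w = 0) → v = 0 := toBilin'_eq_zero hdet
  refine isZeroModel_and_isIsomorphic_of_linearMap model14_isZeroModel hM
    (frameLinearMap (xBlock φ P) (fun i j => deriv (φ i j) (P (X i))) (xCurv φ P))
    (fun v w => ?_) fun v₁ v₂ v₃ v₄ => ?_
  · simp only [frameLinearMap_apply]
    exact form_frameMap (xBlock_symm φ P) (fun i => hφ' i _) _ v w
  · rw [frameLinearMap_apply, frameLinearMap_apply, frameLinearMap_apply, frameLinearMap_apply,
      model14_curv, modelAt_gPhi_curv hφ, curvTensor_frameMap]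

/-! ### Compositions of Jacobi operators -/

/-- Raising the index pairs the factor `φ_{i,1}'` with `φ_{i,2}'`, so every `φ'` cancels and the
result does not depend on `P`. -/
theorem curvPair_jacobi_gPhi (hφ : ∀ i j, ContDiff ℝ ∞ (φ i j))
    (hφ' : ∀ i t, deriv (φ i 0) t * deriv (φ i 1) t = 1) (P x y z w : Coord → ℝ) :
    curvPair (fun i j => deriv (φ i j) (P (X i))) x w x (jacobi (gPhi φ) P y z) =
      let t := curvCov 1 x w x
      let u := curvCov 1 z y y
      t 0 0 * u 0 1 + t 0 1 * u 0 0 + t 1 0 * u 1 1 + t 1 1 * u 1 0 + t 2 0 * u 2 1 + t 2 1 * u 2 0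
        - (8 / 3) * (t 3 0 * u 3 0 + t 3 1 * u 3 1)
        - (4 / 3) * (t 3 0 * u 3 1 + t 3 1 * u 3 0) := by
  simp only [curvPair, jacobi, curvatureAt_gPhi_Y hφ, sum_yBlockInv_mul]
  have e : ∀ x y z : Coord → ℝ, ∀ i j, curvCov (fun i j => deriv (φ i j) (P (X i))) x y z i j =
      frameScale (fun i j => deriv (φ i j) (P (X i))) i j * curvCov 1 x y z i j := by
    intro x y z i j
    fin_cases i <;> fin_cases j <;> simp [curvCov, frameScale]
  simp only [e]
  generalize curvCov 1 x w x = t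
  generalize curvCov 1 z y y = u
  simp [Fin.sum_univ_succ, frameScale]
  linear_combination (t 0 0 * u 0 1 + t 0 1 * u 0 0) * hφ' 0 (P (X 0))
    + (t 1 0 * u 1 1 + t 1 1 * u 1 0) * hφ' 1 (P (X 1))
    + (t 2 0 * u 2 1 + t 2 1 * u 2 0) * hφ' 2 (P (X 2))

theorem form_jacobi_jacobi_gPhi (hφ : ∀ i j, ContDiff ℝ ∞ (φ i j)) (P x y z w : Coord → ℝ) :
    (modelAt (gPhi φ) P).form (jacobi (gPhi φ) P x (jacobi (gPhi φ) P y z)) w =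
      -curvPair (fun i j => deriv (φ i j) (P (X i))) x w x (jacobi (gPhi φ) P y z) := by
  have h := modelAt_gPhi_curv hφ P (jacobi (gPhi φ) P y z) x x w
  have h0 : ∀ i, jacobi (gPhi φ) P y z (X i) = 0 := fun i => curvatureAt_gPhi_X hφ P z y y i
  change (modelAt (gPhi φ) P).curv _ _ _ _ = _
  rw [h]
  generalize jacobi (gPhi φ) P y z = u at h0
  simp [curvTensor, curvPair, curvCov, xCurvTensor, h0, Fin.sum_univ_succ]

/-- On `x`-components put `a = x × w` and `b = z × y`. The terms with `i ≤ 3` sum to `-∑_{i≠j} x_i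
y_j a_j b_i`. Because `a·x = b·y = 0`, the `β_4` block supplies exactly the missing diagonal `-∑ x_i
y_i a_i b_i`, and the total is `-(x·b)(y·a)`. With the sign of `form_jacobi_jacobi_gPhi` this is
`det(x,y,z) det(x,y,w)`; without the `β_4` terms the symmetry in `x`, `y` fails. -/
theorem isJacobiTsankov_gPhi (hφ : ∀ i j, ContDiff ℝ ∞ (φ i j))
    (hφ' : ∀ i t, deriv (φ i 0) t * deriv (φ i 1) t = 1) : IsJacobiTsankov (gPhi φ) := by
  intro P x y z
  rw [← sub_eq_zero]
  refine toBilin'_eq_zero ((isPseudoRiemannian_gPhi hφ).2 P).2 _ fun w => ?_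
  have h1 := form_jacobi_jacobi_gPhi hφ P x y z w
  have h2 := form_jacobi_jacobi_gPhi hφ P y x z w
  rw [curvPair_jacobi_gPhi hφ hφ'] at h1 h2
  rw [map_sub, LinearMap.sub_apply]
  change (modelAt (gPhi φ) P).form _ _ - (modelAt (gPhi φ) P).form _ _ = 0
  rw [h1, h2]
  simp [curvCov]
  ring

theorem not_isTwoStepJacobiNilpotent_gPhi (hφ : ∀ i j, ContDiff ℝ ∞ (φ i j))
    (hφ' : ∀ i t, deriv (φ i 0) t * deriv (φ i 1) t = 1) :
    ¬ IsTwoStepJacobiNilpotent (gPhi φ) := by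
  intro h
  -- For `x = ∂_{x_1}`, `y = ∂_{x_3}`, `z = w = ∂_{x_2}` both determinants are -1, so the value is
  -- 1.
  have h1 := form_jacobi_jacobi_gPhi hφ 0 (Pi.single (X 0) 1) (Pi.single (X 2) 1)
    (Pi.single (X 1) 1) (Pi.single (X 1) 1)
  rw [h, curvPair_jacobi_gPhi hφ hφ'] at h1
  simp [curvCov] at h1

end JTsankov

theorem theorem1p6 (φ : Fin 3 → Fin 2 → ℝ → ℝ) (hφ : ∀ i j, ContDiff ℝ ∞ (φ i j))
    (hφ' : ∀ i t, deriv (φ i 0) t * deriv (φ i 1) t = 1) :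
    JTsankov.IsPseudoRiemannian (JTsankov.gPhi φ) ∧
    JTsankov.IsGeodesicallyComplete (JTsankov.gPhi φ) ∧
    (∀ P : JTsankov.Coord → ℝ,
      ∃ e : Diffeomorph (modelWithCornersSelf ℝ (JTsankov.Coord → ℝ))
          (modelWithCornersSelf ℝ (JTsankov.Coord → ℝ))
          (JTsankov.Coord → ℝ) (JTsankov.Coord → ℝ) ∞,
        JTsankov.IsExpMap (JTsankov.gPhi φ) P e) ∧
    JTsankov.model14.IsZeroModel ∧
    JTsankov.HasZeroModel (JTsankov.gPhi φ) JTsankov.model14 ∧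
    JTsankov.IsJacobiTsankov (JTsankov.gPhi φ) ∧
    ¬ JTsankov.IsTwoStepJacobiNilpotent (JTsankov.gPhi φ) := by
  obtain ⟨hsm, htri⟩ := JTsankov.geodesic_system_gPhi hφ
  exact ⟨JTsankov.isPseudoRiemannian_gPhi hφ,
    JTsankov.isGeodesicallyComplete_of_isTriangular hsm htri,
    JTsankov.exists_diffeomorph_isExpMap_of_isTriangular hsm htri,
    JTsankov.model14_isZeroModel, JTsankov.hasZeroModel_gPhi hφ hφ',
    JTsankov.isJacobiTsankov_gPhi hφ hφ', JTsankov.not_isTwoStepJacobiNilpotent_gPhi hφ hφ'⟩
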